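/- Consider a market with $M\ge 1$ consumers and $N$ firms, an inelastic demand $d_0>0$ per consumer and a capacity $\kappa_0>0$ per firm, where $Md_0<N\kappa_0$. Assumption 1. For each consumer $i$, $U_i$ is concave, strictly increasing and continuously differentiable on $[d_0,\infty)$ with $U_i(d_0)=0$. For each firm $j$, $C_j:\mathbb{R}\to\mathbb{R}$ is convex, strictly increasing, continuously differentiable (one-sidedly at $0$) and nonnegative on $[0,\infty)$, and $C_j(s)=0$ for $s\le 0$. Assumption 2. No firm is pivotal: $\dfrac{(N-1)\kappa_0}{Md_0}>1$. In the game $\mathcal{G}$ consumer $i$ chooses $\theta_d^i\ge 0$ and firm $j$ chooses $\theta_s^j\ge 0$. With $$p=p(\theta_d,\theta_s)=\frac{\sum_{i}\theta_d^i+\sum_{j}\theta_s^j}{N\kappa_0-Md_0},\qquad D(\theta,p)=d_0+\frac{\theta}{p},\qquad S(\theta,p)=\kappa_0-\frac{\theta}{p}$$ (and $D(0,0)=d_0$, $S(0,0)=\kappa_0$), the payoff of consumer $i$ is $U_i(D(\theta_d^i,p))-p\,d_0-\theta_d^i$, and the payoff of firm $j$ is $p\,\kappa_0-\theta_s^j-C_j(S(\theta_s^j,p))$.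 A Nash equilibrium is a profile of nonnegative $\theta_d^i,\theta_s^j$ from which no player gains by a unilateral deviation to another nonnegative number. Let $$\tilde U_i(d)=\Bigl(1-\frac{d}{N\kappa_0-(M-1)d_0}\Bigr)U_i(d)+\frac{1}{N\kappa_0-(M-1)d_0}\int_{d_0}^{d}U_i(z)\,dz,$$ $$\tilde C_j(s)=\Bigl(1+\frac{s}{(N-1)\kappa_0-Md_0}\Bigr)C_j(s)-\frac{1}{(N-1)\kappa_0-Md_0}\int_0^{s}C_j(z)\,dz .$$ Theorem. Suppose Assumptions 1 and 2 hold. Then $\mathcal{G}$ has a Nash equilibrium. It is unique if every $C_j$ is continuously differentiable on all of $\mathbb{R}$ (so that also $C_j'(0)=0$), and also, without this condition, if $Md_0$ is not an integer multiple of $\kappa_0$. Moreover, the program $$\text{maximize } \sum_{i=1}^M\tilde U_i(d_i)-\sum_{j=1}^N\tilde C_j(s_j)\quad\text{subject to } \sum_i d_i=\sum_j s_j,\quad 0\le s_j\le\kappa_0\ \ \forall j,\quad d_i\ge d_0\ \ \forall i$$ is convex (its feasible set is convex and its objective is concave there) and has a unique solution $(\tilde d,\tilde s)$; and at every Nash equilibrium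 $(\tilde\theta_d,\tilde\theta_s)$ the price $p=p(\tilde\theta_d,\tilde\theta_s)$ is positive and $\tilde d_i=D(\tilde\theta_d^i,p)$, $\tilde s_j=S(\tilde\theta_s^j,p)$ for all $i,j$. -/

import Mathlib

/-- The data of a two-sided market with `M` consumers and `N` firms: the inelastic demand `d₀`
of each consumer, the capacity `κ₀` of each firm, the utilities `U i` (relevant on `[d₀, ∞)`
only) and the costs `C i`. -/
structure Market (M N : ℕ) where
  d₀ : ℝ
  κ₀ : ℝ
  U : Fin M → ℝ → ℝ
  C : Fin N → ℝ → ℝ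

namespace Market

variable {M N : ℕ}

/-- Concave utilities on `[d₀, ∞)`, convex costs on `[0, ∞)` that vanish on `(-∞, 0]`.
Continuous differentiability is one-sided at the end points `d₀` and `0`. -/
structure ConcaveUtilitiesConvexCosts (m : Market M N) : Prop where
  utility_concave : ∀ i, ConcaveOn ℝ (Set.Ici m.d₀) (m.U i)
  utility_strictMono : ∀ i, StrictMonoOn (m.U i) (Set.Ici m.d₀)
  utility_contDiff : ∀ i, ContDiffOn ℝ 1 (m.U i) (Set.Ici m.d₀)
  utility_d₀ : ∀ i, m.U i m.d₀ = 0
  cost_convex : ∀ i, ConvexOn ℝ (Set.Ici 0) (m.C i)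
  cost_strictMono : ∀ i, StrictMonoOn (m.C i) (Set.Ici 0)
  cost_contDiff : ∀ i, ContDiffOn ℝ 1 (m.C i) (Set.Ici 0)
  cost_nonneg : ∀ i, ∀ s, 0 ≤ s → 0 ≤ m.C i s
  cost_nonpos : ∀ i, ∀ s, s ≤ 0 → m.C i s = 0

/-- The residual supply index of a firm (all firms have the same capacity). -/
noncomputable def rsi (m : Market M N) (_i : Fin N) : ℝ :=
  (((N : ℝ) - 1) * m.κ₀) / ((M : ℝ) * m.d₀)

/-- No firm is pivotal: every residual supply index exceeds one. -/
def NoPivotalSupplier (m : Market M N) : Prop :=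
  ∀ i : Fin N, 1 < m.rsi i

/-- The demand bid `D(θ, p) = d₀ + θ / p`. Since `0 / 0 = 0` in Lean, this includes the
convention `D(0, 0) = d₀`. -/
noncomputable def demandBid (m : Market M N) (θ p : ℝ) : ℝ :=
  m.d₀ + θ / p

/-- The supply offer `S(θ, p) = κ₀ - θ / p`, with `S(0, 0) = κ₀`. -/
noncomputable def supplyOffer (m : Market M N) (θ p : ℝ) : ℝ :=
  m.κ₀ - θ / p

/-- The market price for the bids `θ.1` of the consumers and the offers `θ.2` of the firms. It
is zero if all of these are zero. -/
noncomputable def price (m : Market M N) (θ : (Fin M → ℝ) × (Fin N → ℝ)) : ℝ :=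
  (∑ i, θ.1 i + ∑ j, θ.2 j) / ((N : ℝ) * m.κ₀ - (M : ℝ) * m.d₀)

/-- The payoff of a price-anticipating consumer. -/
noncomputable def consumerPayoff (m : Market M N) (i : Fin M)
    (θ : (Fin M → ℝ) × (Fin N → ℝ)) : ℝ :=
  m.U i (m.demandBid (θ.1 i) (m.price θ)) - m.price θ * m.d₀ - θ.1 i

/-- The payoff of a price-anticipating firm. -/
noncomputable def firmPayoff (m : Market M N) (j : Fin N)
    (θ : (Fin M → ℝ) × (Fin N → ℝ)) : ℝ :=
  m.price θ * m.κ₀ - θ.2 j - m.C j (m.supplyOffer (θ.2 j) (m.price θ))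

/-- Nash equilibria of the game in which every consumer and every firm chooses a nonnegative
real number. -/
structure IsNashEquilibrium (m : Market M N) (θ : (Fin M → ℝ) × (Fin N → ℝ)) : Prop where
  consumer_nonneg : ∀ i, 0 ≤ θ.1 i
  firm_nonneg : ∀ j, 0 ≤ θ.2 j
  consumer_best : ∀ i, ∀ t : ℝ, 0 ≤ t →
    m.consumerPayoff i (Function.update θ.1 i t, θ.2) ≤ m.consumerPayoff i θ
  firm_best : ∀ j, ∀ t : ℝ, 0 ≤ t →
    m.firmPayoff j (θ.1, Function.update θ.2 j t) ≤ m.firmPayoff j θ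

/-- The demand and supply profiles that result from the bids and offers `θ`. -/
noncomputable def allocation (m : Market M N) (θ : (Fin M → ℝ) × (Fin N → ℝ)) :
    (Fin M → ℝ) × (Fin N → ℝ) :=
  (fun i => m.demandBid (θ.1 i) (m.price θ), fun j => m.supplyOffer (θ.2 j) (m.price θ))

/-- The modified utility `Ũ i`. -/
noncomputable def modifiedUtility (m : Market M N) (i : Fin M) (d : ℝ) : ℝ :=
  (1 - d / ((N : ℝ) * m.κ₀ - ((M : ℝ) - 1) * m.d₀)) * m.U i d
    + 1 / ((N : ℝ) * m.κ₀ - ((M : ℝ) - 1) * m.d₀) * ∫ z in m.d₀..d, m.U i z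

/-- The modified cost `C̃ j`. -/
noncomputable def modifiedCost (m : Market M N) (j : Fin N) (s : ℝ) : ℝ :=
  (1 + s / (((N : ℝ) - 1) * m.κ₀ - (M : ℝ) * m.d₀)) * m.C j s
    - 1 / (((N : ℝ) - 1) * m.κ₀ - (M : ℝ) * m.d₀) * ∫ z in (0 : ℝ)..s, m.C j z

/-- The feasible allocations `(d, s)`. -/
def feasible (m : Market M N) : Set ((Fin M → ℝ) × (Fin N → ℝ)) :=
  {x | ∑ i, x.1 i = ∑ j, x.2 j ∧ (∀ j, 0 ≤ x.2 j ∧ x.2 j ≤ m.κ₀) ∧ ∀ i, m.d₀ ≤ x.1 i}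

/-- The objective of the modified welfare maximization program. -/
noncomputable def modifiedWelfare (m : Market M N) (x : (Fin M → ℝ) × (Fin N → ℝ)) : ℝ :=
  ∑ i, m.modifiedUtility i (x.1 i) - ∑ j, m.modifiedCost j (x.2 j)

/-- `x` solves the modified welfare maximization program. -/
def SolvesModifiedProgram (m : Market M N) (x : (Fin M → ℝ) × (Fin N → ℝ)) : Prop :=
  x ∈ m.feasible ∧ IsMaxOn m.modifiedWelfare m.feasible x

end Market

/-!
A firm is a buyer of a negative quantity, so consumers and firms are players of the same kind: the
net quantities `y` sum to zero, and bids share out the surplus `Nκ₀ - Md₀` in proportion. If the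
other bids sum to `a > 0`, a player chooses `y` at the price `a / (K - y)`, where `K` is the
quantity obtained by taking the whole surplus. The payoff `f y - a * y / (K - y)` is concave in `y`,
and its first-order condition reads `(1 - y / K) * f' y = p`. Since `(1 - y / K) * f' y` is the
derivative of the modified utility (or of minus the modified cost), these conditions are the
Karush-Kuhn-Tucker conditions of the modified program, with the price as multiplier. The program
is strictly concave, which determines the quantities; the price is determined as soon as some
player is not at a corner.
-/

open Set

section Calculus

variable {E : Type*} [NormedAddCommGroup E] [NormedSpace ℝ E]

theorem le_add_of_concaveOn_of_hasFDerivWithinAt {S : Set E} {f : E → ℝ} {f' : E →L[ℝ] ℝ}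
    {x y : E} (hc : ConcaveOn ℝ S f) (hf : HasFDerivWithinAt f f' S x) (hx : x ∈ S)
    (hy : y ∈ S) :
    f y ≤ f x + f' (y - x) := by
  have hmaps : MapsTo (AffineMap.lineMap x y) (Icc (0 : ℝ) 1) S := by
    intro t ht
    exact hc.1.lineMap_mem hx hy ht
  have hline : ConcaveOn ℝ (Icc (0 : ℝ) 1) (f ∘ AffineMap.lineMap x y) :=
    (hc.comp_affineMap (AffineMap.lineMap x y)).subset hmaps (convex_Icc 0 1)
  have hderiv : HasDerivWithinAt (f ∘ AffineMap.lineMap x y) (f' (y - x)) (Icc (0 : ℝ) 1) 0 :=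
    HasFDerivWithinAt.comp_hasDerivWithinAt 0 (by simpa using hf)
      AffineMap.hasDerivWithinAt_lineMap hmaps
  have hslope := hline.slope_le_of_hasDerivWithinAt (left_mem_Icc.2 zero_le_one)
    (right_mem_Icc.2 zero_le_one) zero_lt_one hderiv
  simp only [slope_def_field, Function.comp_apply, AffineMap.lineMap_apply_one,
    AffineMap.lineMap_apply_zero, sub_zero, div_one] at hslope
  linarith

theorem isMaxOn_iff_of_concaveOn_of_hasFDerivWithinAt {S : Set E} {f : E → ℝ}
    {f' : E →L[ℝ] ℝ} {x : E} (hc : ConcaveOn ℝ S f) (hf : HasFDerivWithinAt f f' S x) (hx : x ∈ S) :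
    IsMaxOn f S x ↔ ∀ y ∈ S, f' (y - x) ≤ 0 := by
  refine ⟨fun hmax y hy => hmax.localize.hasFDerivWithinAt_nonpos hf
    (sub_mem_posTangentConeAt_of_segment_subset (hc.1.segment_subset hx hy)), fun h y hy => ?_⟩
  have := le_add_of_concaveOn_of_hasFDerivWithinAt hc hf hx hy
  exact this.trans (by linarith [h y hy])

theorem strictConcaveOn_of_hasDerivWithinAt {S : Set ℝ} {f f' : ℝ → ℝ} (hS : Convex ℝ S)
    (hf : ∀ x ∈ S, HasDerivWithinAt f (f' x) S x) (hf' : StrictAntiOn f' (interior S)) :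
    StrictConcaveOn ℝ S f :=
  StrictAntiOn.strictConcaveOn_of_deriv hS (fun x hx => (hf x hx).continuousWithinAt) <|
    hf'.congr fun x hx => ((hf x (interior_subset hx)).hasDerivAt
      (mem_interior_iff_mem_nhds.1 hx)).deriv.symm

theorem hasDerivWithinAt_one_sub_div_mul_add_integral {f : ℝ → ℝ} {f' a b c K x : ℝ}
    (hc : c ∈ Icc a b) (hcont : ContinuousOn f (Icc a b)) (hx : x ∈ Icc a b)
    (hf : HasDerivWithinAt f f' (Icc a b) x) :
    HasDerivWithinAt (fun y => (1 - y / K) * f y + 1 / K * ∫ z in c..y, f z)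
      ((1 - x / K) * f') (Icc a b) x := by
  have : Fact (x ∈ Icc a b) := ⟨hx⟩
  have hint : HasDerivWithinAt (fun y => ∫ z in c..y, f z) (f x) (Icc a b) x :=
    intervalIntegral.integral_hasDerivWithinAt_right
      (hcont.mono (ordConnected_Icc.uIcc_subset hc hx)).intervalIntegrable
      (hcont.stronglyMeasurableAtFilter_nhdsWithin measurableSet_Icc x) (hcont x hx)
  have hfactor : HasDerivWithinAt (fun y : ℝ => 1 - y / K) (-(1 / K)) (Icc a b) x :=
    ((hasDerivWithinAt_id x _).div_const K).const_sub 1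
  refine ((hfactor.mul hf).add (hint.const_mul (1 / K))).congr_deriv ?_
  ring

end Calculus

section PriceAnticipation

variable {a K : ℝ}

theorem strictMonoOn_mul_div_sub (ha : 0 < a) (hK : 0 < K) :
    StrictMonoOn (fun y => a * y / (K - y)) (Iio K) := by
  intro x hx y hy hxy
  rw [div_lt_div_iff₀ (sub_pos.2 hx) (sub_pos.2 hy)]
  nlinarith [mul_pos ha hK]

theorem convexOn_mul_div_sub (ha : 0 ≤ a) (hK : 0 ≤ K) :
    ConvexOn ℝ (Iio K) fun y => a * y / (K - y) := by
  have hinv : ConvexOn ℝ (Iio K) fun y => (K - y)⁻¹ := by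
    have h := (convexOn_zpow (𝕜 := ℝ) (-1)).comp_affineMap
      (AffineMap.const ℝ ℝ K - AffineMap.id ℝ ℝ)
    refine (h.subset (fun y hy => ?_) (convex_Iio K)).congr fun y _ => ?_
    · simpa using hy
    · simp
  refine ((hinv.smul (mul_nonneg ha hK)).add_const (-a)).congr fun y hy => ?_
  have : K - y ≠ 0 := (sub_pos.2 hy).ne'
  simp only [smul_eq_mul, Pi.add_apply]
  field_simp
  ring

theorem hasDerivWithinAt_mul_div_sub {S : Set ℝ} {x : ℝ} (hx : x ≠ K) :
    HasDerivWithinAt (fun y => a * y / (K - y)) (a * K / (K - x) ^ 2) S x := by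
  refine (((hasDerivWithinAt_id x S).const_mul a).div ((hasDerivWithinAt_id x S).const_sub K)
    (sub_ne_zero.2 hx.symm)).congr_deriv ?_
  simp only [id]
  ring

theorem isMaxOn_sub_mul_div_sub_iff {S : Set ℝ} {f : ℝ → ℝ} {f' x : ℝ} (hc : ConcaveOn ℝ S f)
    (hf : HasDerivWithinAt f f' S x) (hx : x ∈ S) (hxK : x < K) (ha : 0 ≤ a) (hK : 0 < K) :
    IsMaxOn (fun y => f y - a * y / (K - y)) (S ∩ Iio K) x ↔
      ∀ y ∈ S, ((1 - x / K) * f' - a / (K - x)) * (y - x) ≤ 0 := by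
  have hKx : 0 < K - x := sub_pos.2 hxK
  have hS := hc.1.inter (convex_Iio K)
  have hconc : ConcaveOn ℝ (S ∩ Iio K) fun y => f y - a * y / (K - y) :=
    (hc.subset inter_subset_left hS).sub
      ((convexOn_mul_div_sub ha hK.le).subset inter_subset_right hS)
  have hderiv := (hf.sub (hasDerivWithinAt_mul_div_sub (a := a) hxK.ne)).hasFDerivWithinAt
  have hsign (y : ℝ) : (f' - a * K / (K - x) ^ 2) * (y - x) ≤ 0 ↔
      ((1 - x / K) * f' - a / (K - x)) * (y - x) ≤ 0 := by
    have : f' - a * K / (K - x) ^ 2 = K / (K - x) * ((1 - x / K) * f' - a / (K - x)) := by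
      field_simp
    rw [this, mul_assoc]
    exact smul_nonpos_iff_nonpos_of_pos_left (div_pos hK hKx)
  constructor
  · intro hmax y hy
    have hlocal : IsLocalMaxOn (fun y => f y - a * y / (K - y)) S x := by
      have := hmax.localize
      rwa [IsLocalMaxOn, nhdsWithin_inter_of_mem' (mem_nhdsWithin_of_mem_nhds (Iio_mem_nhds hxK))]
        at this
    have := hlocal.hasFDerivWithinAt_nonpos hderiv
      (sub_mem_posTangentConeAt_of_segment_subset (hc.1.segment_subset hx hy))
    rw [← hsign]
    simpa [mul_comm] using this
  · intro h
    refine (isMaxOn_iff_of_concaveOn_of_hasFDerivWithinAt hconc (hderiv.mono inter_subset_left)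
      ⟨hx, hxK⟩).2 fun y hy => ?_
    have := (hsign y).2 (h y hy.1)
    simpa [mul_comm] using this

end PriceAnticipation

section SeparablePrograms

variable {ι : Type*} [Fintype ι] {S : ι → Set ℝ} {f : ι → ℝ → ℝ}

theorem strictConcaveOn_sum_pi (hf : ∀ k, StrictConcaveOn ℝ (S k) (f k)) :
    StrictConcaveOn ℝ (univ.pi S) fun x => ∑ k, f k (x k) := by
  refine ⟨convex_pi fun k _ => (hf k).1, fun x hx y hy hxy a b ha hb hab => ?_⟩
  obtain ⟨k, hk⟩ := Function.ne_iff.1 hxy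
  simp only [Finset.smul_sum, ← Finset.sum_add_distrib]
  exact Finset.sum_lt_sum
    (fun i _ => (hf i).concaveOn.2 (hx i trivial) (hy i trivial) ha.le hb.le hab)
    ⟨k, Finset.mem_univ k, (hf k).2 (hx k trivial) (hy k trivial) hk ha hb hab⟩

theorem hasFDerivWithinAt_sum_pi {g x : ι → ℝ} {A : Set (ι → ℝ)} (hA : A ⊆ univ.pi S)
    (hf : ∀ k, HasDerivWithinAt (f k) (g k) (S k) (x k)) :
    HasFDerivWithinAt (fun z => ∑ k, f k (z k))
      (∑ k, g k • (ContinuousLinearMap.proj k : (ι → ℝ) →L[ℝ] ℝ)) A x :=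
  HasFDerivWithinAt.fun_sum fun k _ => (hf k).comp_hasFDerivWithinAt x
    (ContinuousLinearMap.proj (R := ℝ) (φ := fun _ : ι => ℝ) k).hasFDerivWithinAt
      fun _ hz => hA hz k trivial

theorem coeff_le_of_forall_sum_mul_sub_nonpos {g x : ι → ℝ} {k l : ι} {y z : ℝ}
    (hS : ∀ i, (S i).OrdConnected) (hx : ∀ i, x i ∈ S i)
    (hmax : ∀ w : ι → ℝ, (∀ i, w i ∈ S i) → ∑ i, w i = ∑ i, x i → ∑ i, g i * (w i - x i) ≤ 0)
    (hy : y ∈ S k) (hxy : x k < y) (hz : z ∈ S l) (hzx : z < x l) : g k ≤ g l := by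
  classical
  rcases eq_or_ne k l with rfl | hkl
  · exact le_rfl
  obtain ⟨δ, hδ, hδy, hδz⟩ : ∃ δ, 0 < δ ∧ δ ≤ y - x k ∧ δ ≤ x l - z :=
    ⟨_, lt_min (sub_pos.2 hxy) (sub_pos.2 hzx), min_le_left _ _, min_le_right _ _⟩
  set w : ι → ℝ := x + Pi.single k δ - Pi.single l δ with hw
  have hwS : ∀ i, w i ∈ S i := by
    intro i
    rcases eq_or_ne i k with rfl | hik
    · simpa [hw, hkl] using (hS i).out (hx i) hy ⟨by linarith, by linarith⟩
    rcases eq_or_ne i l with rfl | hil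
    · simpa [hw, hik] using (hS i).out hz (hx i) ⟨by linarith, by linarith⟩
    · simpa [hw, hik, hil] using hx i
  have hgain := hmax w hwS (by simp [hw, Finset.sum_add_distrib, Finset.sum_sub_distrib])
  have hsum : ∑ i, g i * (w i - x i) = g k * δ - g l * δ := by
    have hdiff : w - x = Pi.single k δ - Pi.single l δ := by
      rw [hw, add_sub_assoc, add_sub_cancel_left]
    simp only [← Pi.sub_apply, hdiff]
    simp [mul_sub, Finset.sum_sub_distrib, Pi.single_apply]
  rw [hsum] at hgain
  exact le_of_mul_le_mul_right (sub_nonpos.1 hgain) hδ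

-- The multiplier is the largest coefficient among the coordinates that can still be increased.
theorem exists_multiplier {g x : ι → ℝ} (hS : ∀ i, (S i).OrdConnected)
    (hx : ∀ i, x i ∈ S i)
    (hmax : ∀ w : ι → ℝ, (∀ i, w i ∈ S i) → ∑ i, w i = ∑ i, x i → ∑ i, g i * (w i - x i) ≤ 0)
    (hup : ∃ k, ∃ y ∈ S k, x k < y) :
    ∃ p, ∀ k, ∀ y ∈ S k, (g k - p) * (y - x k) ≤ 0 := by
  classical
  obtain ⟨k, hk, hkmax⟩ := ({k | ∃ y ∈ S k, x k < y} : Finset ι).exists_max_image g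
    (by simpa [Finset.Nonempty] using hup)
  obtain ⟨y₀, hy₀, hxy₀⟩ : ∃ y ∈ S k, x k < y := by simpa using hk
  refine ⟨g k, fun l y hy => ?_⟩
  rcases lt_trichotomy (x l) y with hlt | heq | hgt
  · exact mul_nonpos_of_nonpos_of_nonneg
      (sub_nonpos.2 (hkmax l (by simpa using ⟨y, hy, hlt⟩))) (sub_pos.2 hlt).le
  · simp [heq]
  · exact mul_nonpos_of_nonneg_of_nonpos
      (sub_nonneg.2 (coeff_le_of_forall_sum_mul_sub_nonpos hS hx hmax hy₀ hxy₀ hy hgt))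
      (sub_neg.2 hgt).le

end SeparablePrograms

/-- A game in which players compete for net quantities summing to zero by submitting nonnegative
bids. Player `k` receives at least `floor k` and gains nothing beyond `ceiling k`. A firm is a
player whose net quantity is minus its supply. -/
structure BidGame (ι : Type*) where
  floor : ι → ℝ
  ceiling : ι → ℝ
  value : ι → ℝ → ℝ

namespace BidGame

variable {ι : Type*} [Fintype ι] {G : BidGame ι} {θ x : ι → ℝ} {p : ℝ} {k : ι}

/-- The quantity that the bids distribute on top of the floors, `Nκ₀ - Md₀` in a market. -/
def surplus (G : BidGame ι) : ℝ :=
  -∑ k, G.floor k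

/-- The net quantity of a player who gets the whole surplus: the constant by which that player's
market power enters the modified value. -/
def reach (G : BidGame ι) (k : ι) : ℝ :=
  G.floor k + G.surplus

/-- The price at which the bids pay for the surplus. -/
noncomputable def price (G : BidGame ι) (θ : ι → ℝ) : ℝ :=
  (∑ k, θ k) / G.surplus

/-- The net quantity bought by a player; it is the floor if the price is zero. -/
noncomputable def quantity (G : BidGame ι) (θ : ι → ℝ) (k : ι) : ℝ :=
  G.floor k + θ k / G.price θ

/-- The payoff of a price-anticipating player. -/
noncomputable def payoff (G : BidGame ι) (k : ι) (θ : ι → ℝ) : ℝ :=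
  G.value k (G.quantity θ k) - G.price θ * G.floor k - θ k

/-- The sum of the bids of the opponents of player `k`. -/
def othersBid (θ : ι → ℝ) (k : ι) : ℝ :=
  ∑ i, θ i - θ k

/-- Nash equilibria among nonnegative bids. -/
structure IsEquilibrium [DecidableEq ι] (G : BidGame ι) (θ : ι → ℝ) : Prop where
  nonneg : ∀ k, 0 ≤ θ k
  best : ∀ k, ∀ t : ℝ, 0 ≤ t → G.payoff k (Function.update θ k t) ≤ G.payoff k θ

/-- The net quantities that balance and lie between floor and ceiling. -/
def feasible (G : BidGame ι) : Set (ι → ℝ) :=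
  {x | ∑ k, x k = 0 ∧ ∀ k, x k ∈ Icc (G.floor k) (G.ceiling k)}

/-- The marginal value of player `k`, shaded because buying more raises the price. -/
noncomputable def modifiedMarginal (G : BidGame ι) (k : ι) (y : ℝ) : ℝ :=
  (1 - y / G.reach k) * derivWithin (G.value k) (Icc (G.floor k) (G.ceiling k)) y

/-- The functions `F k` are antiderivatives of the modified marginal values. No base point is fixed
because `Ũ i` is normalized at the floor and `C̃ j` at the ceiling. -/
def IsModifiedValue (G : BidGame ι) (F : ι → ℝ → ℝ) : Prop :=
  ∀ k, ∀ y ∈ Icc (G.floor k) (G.ceiling k),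
    HasDerivWithinAt (F k) (G.modifiedMarginal k y) (Icc (G.floor k) (G.ceiling k)) y

/-- The Karush-Kuhn-Tucker conditions for maximizing the sum of the modified values over the
feasible net quantities, with multiplier `p` for the balance constraint. -/
structure IsSupportedBy (G : BidGame ι) (x : ι → ℝ) (p : ℝ) : Prop where
  mem_feasible : x ∈ G.feasible
  variational : ∀ k, ∀ y ∈ Icc (G.floor k) (G.ceiling k),
    (G.modifiedMarginal k (x k) - p) * (y - x k) ≤ 0

/-- The bids that buy the net quantities `x` at the price `p`. -/
def bids (G : BidGame ι) (x : ι → ℝ) (p : ℝ) : ι → ℝ :=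
  fun k => p * (x k - G.floor k)

/-- The standing assumptions on the values, together with the condition that no player is pivotal:
by `reach_pos`, the floors of the opponents of any one player still have a negative sum. -/
structure IsRegular (G : BidGame ι) : Prop where
  reach_pos : ∀ k, 0 < G.reach k
  floor_lt_ceiling : ∀ k, G.floor k < G.ceiling k
  ceiling_le_reach : ∀ k, G.ceiling k ≤ G.reach k
  sum_ceiling_pos : 0 < ∑ k, G.ceiling k
  concaveOn : ∀ k, ConcaveOn ℝ (Icc (G.floor k) (G.ceiling k)) (G.value k)
  strictMonoOn : ∀ k, StrictMonoOn (G.value k) (Icc (G.floor k) (G.ceiling k))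
  differentiableOn : ∀ k, DifferentiableOn ℝ (G.value k) (Icc (G.floor k) (G.ceiling k))
  value_eq : ∀ k, ∀ y ∈ Icc (G.ceiling k) (G.reach k), G.value k y = G.value k (G.ceiling k)

theorem IsRegular.surplus_pos (hG : G.IsRegular) : 0 < G.surplus := by
  obtain ⟨k, -, -⟩ := Finset.exists_ne_zero_of_sum_ne_zero hG.sum_ceiling_pos.ne'
  have := (hG.floor_lt_ceiling k).trans_le (hG.ceiling_le_reach k)
  rwa [reach, lt_add_iff_pos_right] at this

section Bids

theorem othersBid_update [DecidableEq ι] (θ : ι → ℝ) (k : ι) (t : ℝ) :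
    othersBid (Function.update θ k t) k = othersBid θ k := by
  have := Finset.sum_update_of_mem (Finset.mem_univ k) θ t
  have := Finset.sum_update_of_mem (Finset.mem_univ k) θ (θ k)
  simp_all [othersBid]

theorem price_mul_surplus (hsurplus : G.surplus ≠ 0) (θ : ι → ℝ) (k : ι) :
    G.price θ * G.surplus = θ k + othersBid θ k := by
  rw [price, div_mul_cancel₀ _ hsurplus, othersBid, add_sub_cancel]

theorem price_pos (hsurplus : 0 < G.surplus) (hθ : 0 ≤ θ k) (ha : 0 < othersBid θ k) :
    0 < G.price θ :=
  pos_of_mul_pos_left (by rw [price_mul_surplus hsurplus.ne' θ k]; positivity) hsurplus.le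

theorem price_mul_reach_sub_quantity (hsurplus : G.surplus ≠ 0) (hp : G.price θ ≠ 0) (k : ι) :
    G.price θ * (G.reach k - G.quantity θ k) = othersBid θ k := by
  rw [reach, quantity, add_sub_add_left_eq_sub, mul_sub, price_mul_surplus hsurplus θ k,
    mul_div_cancel₀ _ hp, add_sub_cancel_left]

theorem payoff_eq (hp : G.price θ ≠ 0) (k : ι) :
    G.payoff k θ = G.value k (G.quantity θ k) - G.price θ * G.quantity θ k := by
  rw [payoff, sub_sub]
  congr 1
  rw [quantity, mul_add, mul_div_cancel₀ _ hp]

theorem bids_quantity (hp : G.price θ ≠ 0) : G.bids (G.quantity θ) (G.price θ) = θ := by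
  funext k
  rw [bids, quantity, add_sub_cancel_left, mul_div_cancel₀ _ hp]

theorem price_bids (hsurplus : G.surplus ≠ 0) (hx : ∑ k, x k = 0) (p : ℝ) :
    G.price (G.bids x p) = p := by
  have : ∑ k, G.bids x p k = p * G.surplus := by
    simp only [bids, ← Finset.mul_sum, Finset.sum_sub_distrib, hx, zero_sub, surplus]
  rw [price, this, mul_div_cancel_right₀ _ hsurplus]

theorem quantity_bids (hsurplus : G.surplus ≠ 0) (hx : ∑ k, x k = 0) (hp : p ≠ 0) :
    G.quantity (G.bids x p) = x := by
  funext k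
  rw [quantity, price_bids hsurplus hx, bids, mul_div_cancel_left₀ _ hp, add_sub_cancel]

theorem sum_quantity (hsurplus : G.surplus ≠ 0) (hp : G.price θ ≠ 0) : ∑ k, G.quantity θ k = 0 := by
  have hθ : ∑ k, θ k = G.price θ * G.surplus := (div_mul_cancel₀ _ hsurplus).symm
  simp only [quantity, Finset.sum_add_distrib, ← Finset.sum_div]
  rw [hθ, mul_div_cancel_left₀ _ hp, surplus, add_neg_cancel]

theorem quantity_mem_Ico (hsurplus : 0 < G.surplus) (hθ : 0 ≤ θ k) (ha : 0 < othersBid θ k) :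
    G.quantity θ k ∈ Ico (G.floor k) (G.reach k) := by
  have hp := price_pos hsurplus hθ ha
  refine ⟨le_add_of_nonneg_right (div_nonneg hθ hp.le), sub_pos.1 ?_⟩
  exact pos_of_mul_pos_right (by rwa [price_mul_reach_sub_quantity hsurplus.ne' hp.ne']) hp.le

theorem price_eq_othersBid_div (hsurplus : 0 < G.surplus) (hθ : 0 ≤ θ k) (ha : 0 < othersBid θ k) :
    G.price θ = othersBid θ k / (G.reach k - G.quantity θ k) := by
  rw [eq_div_iff (sub_pos.2 (quantity_mem_Ico hsurplus hθ ha).2).ne',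
    price_mul_reach_sub_quantity hsurplus.ne' (price_pos hsurplus hθ ha).ne']

theorem payoff_eq_of_othersBid_pos (hsurplus : 0 < G.surplus) (hθ : 0 ≤ θ k)
    (ha : 0 < othersBid θ k) :
    G.payoff k θ = G.value k (G.quantity θ k) -
      othersBid θ k * G.quantity θ k / (G.reach k - G.quantity θ k) := by
  rw [payoff_eq (price_pos hsurplus hθ ha).ne', mul_div_right_comm,
    ← price_eq_othersBid_div hsurplus hθ ha]

theorem exists_quantity_update_eq [DecidableEq ι] (hsurplus : 0 < G.surplus)
    (ha : 0 < othersBid θ k) {y : ℝ} (hy : y ∈ Ico (G.floor k) (G.reach k)) :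
    ∃ t, 0 ≤ t ∧ G.quantity (Function.update θ k t) k = y := by
  have hy' : 0 < G.reach k - y := sub_pos.2 hy.2
  refine ⟨othersBid θ k / (G.reach k - y) * (y - G.floor k),
    mul_nonneg (by positivity) (sub_nonneg.2 hy.1), ?_⟩
  set t := othersBid θ k / (G.reach k - y) * (y - G.floor k) with ht
  have hprice : G.price (Function.update θ k t) = othersBid θ k / (G.reach k - y) := by
    refine mul_right_cancel₀ hsurplus.ne' ?_
    rw [price_mul_surplus hsurplus.ne' _ k, othersBid_update, Function.update_self, ht]
    have : G.surplus = G.reach k - y + (y - G.floor k) := by simp [reach]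
    rw [this, mul_add, div_mul_cancel₀ _ hy'.ne', add_comm]
  rw [quantity, hprice, Function.update_self, ht, mul_div_cancel_left₀ _ (by positivity),
    add_sub_cancel]

end Bids

section BestResponse

theorem forall_payoff_update_le_iff [DecidableEq ι] (hsurplus : 0 < G.surplus) (hθ : 0 ≤ θ k)
    (ha : 0 < othersBid θ k) :
    (∀ t, 0 ≤ t → G.payoff k (Function.update θ k t) ≤ G.payoff k θ) ↔
      IsMaxOn (fun y => G.value k y - othersBid θ k * y / (G.reach k - y))
        (Ico (G.floor k) (G.reach k)) (G.quantity θ k) := by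
  have hnonneg {t : ℝ} (ht : 0 ≤ t) : 0 ≤ Function.update θ k t k := by simpa using ht
  have hothers (t : ℝ) : 0 < othersBid (Function.update θ k t) k := by rwa [othersBid_update]
  rw [payoff_eq_of_othersBid_pos hsurplus hθ ha]
  constructor
  · intro h y hy
    obtain ⟨t, ht, rfl⟩ := exists_quantity_update_eq hsurplus ha hy
    have := h t ht
    rwa [payoff_eq_of_othersBid_pos hsurplus (hnonneg ht) (hothers t), othersBid_update] at this
  · intro h t ht
    rw [payoff_eq_of_othersBid_pos hsurplus (hnonneg ht) (hothers t), othersBid_update]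
    exact h (quantity_mem_Ico hsurplus (hnonneg ht) (hothers t))

theorem IsRegular.isMaxOn_Ico_iff (hG : G.IsRegular) {a y : ℝ} (ha : 0 < a)
    (hy : y ∈ Ico (G.floor k) (G.reach k)) :
    IsMaxOn (fun y => G.value k y - a * y / (G.reach k - y)) (Ico (G.floor k) (G.reach k)) y ↔
      y ≤ G.ceiling k ∧ IsMaxOn (fun y => G.value k y - a * y / (G.reach k - y))
        (Icc (G.floor k) (G.ceiling k) ∩ Iio (G.reach k)) y := by
  have hsatiated : ∀ z ∈ Ioo (G.ceiling k) (G.reach k),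
      G.value k z - a * z / (G.reach k - z) <
        G.value k (G.ceiling k) - a * G.ceiling k / (G.reach k - G.ceiling k) := by
    intro z hz
    rw [hG.value_eq k z (Ioo_subset_Icc_self hz)]
    exact sub_lt_sub_left (strictMonoOn_mul_div_sub ha (hG.reach_pos k)
      (hz.1.trans hz.2) hz.2 hz.1) _
  constructor
  · intro h
    refine ⟨not_lt.1 fun hlt => ?_, h.on_subset fun z hz => ⟨hz.1.1, hz.2⟩⟩
    exact (hsatiated y ⟨hlt, hy.2⟩).not_ge (h ⟨(hG.floor_lt_ceiling k).le, hlt.trans hy.2⟩)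
  · rintro ⟨-, h⟩ z hz
    rcases le_or_gt z (G.ceiling k) with hle | hgt
    · exact h ⟨⟨hz.1, hle⟩, hz.2⟩
    · exact (hsatiated z ⟨hgt, hz.2⟩).le.trans
        (h ⟨right_mem_Icc.2 (hG.floor_lt_ceiling k).le, hgt.trans hz.2⟩)

theorem IsRegular.forall_payoff_update_le_iff_variational [DecidableEq ι] (hG : G.IsRegular)
    (hθ : 0 ≤ θ k) (ha : 0 < othersBid θ k) :
    (∀ t, 0 ≤ t → G.payoff k (Function.update θ k t) ≤ G.payoff k θ) ↔
      G.quantity θ k ≤ G.ceiling k ∧ ∀ y ∈ Icc (G.floor k) (G.ceiling k),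
        (G.modifiedMarginal k (G.quantity θ k) - G.price θ) * (y - G.quantity θ k) ≤ 0 := by
  have hq := quantity_mem_Ico hG.surplus_pos hθ ha
  rw [forall_payoff_update_le_iff hG.surplus_pos hθ ha, hG.isMaxOn_Ico_iff ha hq]
  refine and_congr_right fun hle => ?_
  rw [isMaxOn_sub_mul_div_sub_iff (hG.concaveOn k)
    (hG.differentiableOn k _ ⟨hq.1, hle⟩).hasDerivWithinAt ⟨hq.1, hle⟩ hq.2 ha.le
    (hG.reach_pos k), ← price_eq_othersBid_div hG.surplus_pos hθ ha]
  rfl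

theorem IsRegular.value_floor_lt_value_reach (hG : G.IsRegular) (k : ι) :
    G.value k (G.floor k) < G.value k (G.reach k) := by
  have hlt := hG.floor_lt_ceiling k
  rw [hG.value_eq k _ (right_mem_Icc.2 (hG.ceiling_le_reach k))]
  exact hG.strictMonoOn k (left_mem_Icc.2 hlt.le) (right_mem_Icc.2 hlt.le) hlt

theorem payoff_of_othersBid_eq_zero (hsurplus : 0 < G.surplus) (ha : othersBid θ k = 0)
    (hθ : 0 < θ k) :
    G.payoff k θ = G.value k (G.reach k) - θ k / G.surplus * G.reach k := by
  have hprice : G.price θ = θ k / G.surplus := by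
    rw [eq_div_iff hsurplus.ne', price_mul_surplus hsurplus.ne' θ k, ha, add_zero]
  have hp : 0 < G.price θ := hprice ▸ div_pos hθ hsurplus
  have hq : G.quantity θ k = G.reach k := by
    have := price_mul_reach_sub_quantity hsurplus.ne' hp.ne' k
    rw [ha, mul_eq_zero, or_iff_right hp.ne', sub_eq_zero] at this
    exact this.symm
  rw [payoff_eq hp.ne', hq, hprice]

theorem IsRegular.payoff_lt_of_othersBid_eq_zero (hG : G.IsRegular) (ha : othersBid θ k = 0)
    (hθ : 0 ≤ θ k) : G.payoff k θ < G.value k (G.reach k) := by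
  have hsurplus := hG.surplus_pos
  rcases hθ.eq_or_lt with h0 | hpos
  · have hprice : G.price θ = 0 := by
      refine (mul_eq_zero_iff_right hsurplus.ne').1 ?_
      rw [price_mul_surplus hsurplus.ne' θ k, ha, ← h0, add_zero]
    simpa [payoff, quantity, hprice, ← h0] using hG.value_floor_lt_value_reach k
  · rw [payoff_of_othersBid_eq_zero hsurplus ha hpos]
    exact sub_lt_self _ (mul_pos (div_pos hpos hsurplus) (hG.reach_pos k))

-- A player facing no other bids gets the whole surplus for an arbitrarily small bid.
theorem IsEquilibrium.othersBid_pos [DecidableEq ι] (h : G.IsEquilibrium θ) (hG : G.IsRegular)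
    (k : ι) : 0 < othersBid θ k := by
  have hnonneg : 0 ≤ othersBid θ k :=
    sub_nonneg.2 (Finset.single_le_sum (fun i _ => h.nonneg i) (Finset.mem_univ k))
  refine hnonneg.lt_of_ne' fun ha => ?_
  have hsurplus := hG.surplus_pos
  have hK := hG.reach_pos k
  obtain ⟨ε, hε, hgap⟩ := exists_between (hG.payoff_lt_of_othersBid_eq_zero ha (h.nonneg k))
  have ht : 0 < (G.value k (G.reach k) - ε) * G.surplus / G.reach k :=
    div_pos (mul_pos (sub_pos.2 hgap) hsurplus) hK
  have hbest := h.best k _ ht.le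
  rw [payoff_of_othersBid_eq_zero hsurplus (by rwa [othersBid_update]) (by simpa using ht),
    Function.update_self] at hbest
  field_simp at hbest
  linarith

end BestResponse

section Multipliers

theorem IsRegular.derivWithin_value_pos (hG : G.IsRegular) {y : ℝ}
    (hy : y ∈ Ico (G.floor k) (G.ceiling k)) :
    0 < derivWithin (G.value k) (Icc (G.floor k) (G.ceiling k)) y := by
  have hmem := Ico_subset_Icc_self hy
  have hceiling := right_mem_Icc.2 (hG.floor_lt_ceiling k).le
  have hslope := (hG.concaveOn k).slope_le_of_hasDerivWithinAt hmem hceiling hy.2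
    (hG.differentiableOn k y hmem).hasDerivWithinAt
  rw [slope_def_field] at hslope
  exact (div_pos (sub_pos.2 (hG.strictMonoOn k hmem hceiling hy.2))
    (sub_pos.2 hy.2)).trans_le hslope

theorem IsRegular.one_sub_div_reach_pos (hG : G.IsRegular) {y : ℝ} (hy : y < G.ceiling k) :
    0 < 1 - y / G.reach k :=
  sub_pos.2 ((div_lt_one (hG.reach_pos k)).2 (hy.trans_le (hG.ceiling_le_reach k)))

theorem IsRegular.modifiedMarginal_pos (hG : G.IsRegular) {y : ℝ}
    (hy : y ∈ Ico (G.floor k) (G.ceiling k)) : 0 < G.modifiedMarginal k y :=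
  mul_pos (hG.one_sub_div_reach_pos hy.2) (hG.derivWithin_value_pos hy)

theorem IsRegular.strictAntiOn_modifiedMarginal (hG : G.IsRegular) (k : ι) :
    StrictAntiOn (G.modifiedMarginal k) (Ico (G.floor k) (G.ceiling k)) := by
  intro y hy z hz hyz
  have hanti := (hG.concaveOn k).antitoneOn_derivWithin (hG.differentiableOn k)
    (Ico_subset_Icc_self hy) (Ico_subset_Icc_self hz) hyz.le
  refine mul_lt_mul ?_ hanti (hG.derivWithin_value_pos hz) (hG.one_sub_div_reach_pos hy.2).le
  exact sub_lt_sub_left (div_lt_div_of_pos_right hyz (hG.reach_pos k)) 1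

theorem IsRegular.exists_lt_ceiling (hG : G.IsRegular) (hx : x ∈ G.feasible) :
    ∃ k, x k < G.ceiling k := by
  by_contra! h
  exact (hG.sum_ceiling_pos.trans_le (Finset.sum_le_sum fun k _ => h k)).ne' hx.1

theorem IsSupportedBy.multiplier_pos (h : G.IsSupportedBy x p) (hG : G.IsRegular) : 0 < p := by
  obtain ⟨k, hk⟩ := hG.exists_lt_ceiling h.mem_feasible
  have hle := h.variational k _ (right_mem_Icc.2 (hG.floor_lt_ceiling k).le)
  have hmarginal := hG.modifiedMarginal_pos ⟨(h.mem_feasible.2 k).1, hk⟩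
  linarith [nonpos_of_mul_nonpos_left hle (sub_pos.2 hk)]

theorem IsSupportedBy.lt_ceiling (h : G.IsSupportedBy x p) (hG : G.IsRegular)
    (hk : G.modifiedMarginal k (G.ceiling k) = 0) : x k < G.ceiling k := by
  refine (h.mem_feasible.2 k).2.lt_of_ne fun heq => ?_
  have hlt := hG.floor_lt_ceiling k
  have hle := h.variational k _ (left_mem_Icc.2 hlt.le)
  rw [heq, hk, zero_sub, neg_mul, neg_nonpos] at hle
  exact hle.not_gt (mul_neg_of_pos_of_neg (h.multiplier_pos hG) (sub_neg.2 hlt))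

theorem IsRegular.modifiedMarginal_ceiling_eq_zero (hG : G.IsRegular)
    (hk : G.ceiling k = G.reach k) : G.modifiedMarginal k (G.ceiling k) = 0 := by
  rw [modifiedMarginal, hk, div_self (hG.reach_pos k).ne', sub_self, zero_mul]

theorem IsSupportedBy.lt_reach (h : G.IsSupportedBy x p) (hG : G.IsRegular) (k : ι) :
    x k < G.reach k := by
  rcases (hG.ceiling_le_reach k).eq_or_lt with heq | hlt
  · exact heq ▸ h.lt_ceiling hG (hG.modifiedMarginal_ceiling_eq_zero heq)
  · exact (h.mem_feasible.2 k).2.trans_lt hlt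

theorem IsSupportedBy.modifiedMarginal_eq (h : G.IsSupportedBy x p)
    (hk : x k ∈ Ioo (G.floor k) (G.ceiling k)) : G.modifiedMarginal k (x k) = p := by
  have hlt := hk.1.trans hk.2
  have hup := h.variational k _ (right_mem_Icc.2 hlt.le)
  have hdown := h.variational k _ (left_mem_Icc.2 hlt.le)
  have hle := nonpos_of_mul_nonpos_left hup (sub_pos.2 hk.2)
  have hge := nonneg_of_mul_nonpos_left hdown (sub_neg.2 hk.1)
  linarith

theorem IsSupportedBy.exists_mem_Ioo (h : G.IsSupportedBy x p) (hG : G.IsRegular)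
    (hzero : ∀ k, G.modifiedMarginal k (G.ceiling k) = 0) :
    ∃ k, x k ∈ Ioo (G.floor k) (G.ceiling k) := by
  by_contra! hcorner
  have hfloor : ∀ k, x k = G.floor k := fun k =>
    (h.mem_feasible.2 k).1.antisymm' <| not_lt.1 fun hlt =>
      hcorner k ⟨hlt, h.lt_ceiling hG (hzero k)⟩
  have hsum := h.mem_feasible.1
  rw [Finset.sum_congr rfl fun k _ => hfloor k] at hsum
  exact hG.surplus_pos.ne' (neg_eq_zero.2 hsum)

end Multipliers

section Equilibria

theorem IsRegular.isEquilibrium_iff [DecidableEq ι] (hG : G.IsRegular) :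
    G.IsEquilibrium θ ↔
      (∀ k, 0 ≤ θ k) ∧ 0 < G.price θ ∧ G.IsSupportedBy (G.quantity θ) (G.price θ) := by
  have hsurplus := hG.surplus_pos
  constructor
  · intro h
    have hothers := h.othersBid_pos hG
    obtain ⟨k, -⟩ := Finset.exists_ne_zero_of_sum_ne_zero hG.sum_ceiling_pos.ne'
    have hp := price_pos hsurplus (h.nonneg k) (hothers k)
    have hbest k := (hG.forall_payoff_update_le_iff_variational (h.nonneg k) (hothers k)).1
      (h.best k)
    exact ⟨h.nonneg, hp, ⟨sum_quantity hsurplus.ne' hp.ne', fun k =>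
      ⟨(quantity_mem_Ico hsurplus (h.nonneg k) (hothers k)).1, (hbest k).1⟩⟩, fun k => (hbest k).2⟩
  · rintro ⟨hθ, hp, h⟩
    refine ⟨hθ, fun k => (hG.forall_payoff_update_le_iff_variational (hθ k) ?_).2
      ⟨(h.mem_feasible.2 k).2, h.variational k⟩⟩
    rw [← price_mul_reach_sub_quantity hsurplus.ne' hp.ne']
    exact mul_pos hp (sub_pos.2 (h.lt_reach hG k))

theorem IsSupportedBy.isEquilibrium_bids [DecidableEq ι] (h : G.IsSupportedBy x p)
    (hG : G.IsRegular) : G.IsEquilibrium (G.bids x p) := by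
  have hp := h.multiplier_pos hG
  have hsurplus := hG.surplus_pos.ne'
  rw [hG.isEquilibrium_iff, price_bids hsurplus h.mem_feasible.1,
    quantity_bids hsurplus h.mem_feasible.1 hp.ne']
  exact ⟨fun k => mul_nonneg hp.le (sub_nonneg.2 (h.mem_feasible.2 k).1), hp, h⟩

end Equilibria

section ModifiedProgram

variable {F : ι → ℝ → ℝ}

theorem feasible_eq_inter_pi (G : BidGame ι) :
    G.feasible = {x | ∑ k, x k = 0} ∩ univ.pi fun k => Icc (G.floor k) (G.ceiling k) := by
  ext x
  exact and_congr_right' mem_univ_pi.symm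

theorem convex_feasible (G : BidGame ι) : Convex ℝ G.feasible := by
  have hsum : IsLinearMap ℝ fun x : ι → ℝ => ∑ k, x k :=
    ⟨fun x y => Finset.sum_add_distrib, fun c x => (Finset.mul_sum _ _ _).symm⟩
  rw [feasible_eq_inter_pi]
  exact (convex_hyperplane hsum 0).inter (convex_pi fun k _ => convex_Icc _ _)

theorem isCompact_feasible (G : BidGame ι) : IsCompact G.feasible := by
  rw [feasible_eq_inter_pi]
  exact (isCompact_univ_pi fun k => isCompact_Icc).inter_left
    (isClosed_eq (by fun_prop) continuous_const)

theorem IsRegular.nonempty_feasible (hG : G.IsRegular) : G.feasible.Nonempty := by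
  have hfloor : ∑ k, G.floor k < 0 := neg_pos.1 hG.surplus_pos
  obtain ⟨t, ht, hzero⟩ : ∃ t ∈ Icc (0 : ℝ) 1,
      ∑ k, AffineMap.lineMap (G.floor k) (G.ceiling k) t = 0 := by
    refine intermediate_value_Icc zero_le_one ?_ ?_
    · simp only [AffineMap.lineMap_apply_ring']
      fun_prop
    · simpa using ⟨hfloor.le, hG.sum_ceiling_pos.le⟩
  refine ⟨fun k => AffineMap.lineMap (G.floor k) (G.ceiling k) t, hzero, fun k => ?_⟩
  exact (convex_Icc _ _).lineMap_mem (left_mem_Icc.2 (hG.floor_lt_ceiling k).le)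
    (right_mem_Icc.2 (hG.floor_lt_ceiling k).le) ht

theorem IsModifiedValue.strictConcaveOn (hF : G.IsModifiedValue F) (hG : G.IsRegular) :
    StrictConcaveOn ℝ G.feasible fun x => ∑ k, F k (x k) := by
  refine (strictConcaveOn_sum_pi fun k => strictConcaveOn_of_hasDerivWithinAt
    (convex_Icc _ _) (hF k) ?_).subset (fun x hx k _ => hx.2 k) G.convex_feasible
  rw [interior_Icc]
  exact (hG.strictAntiOn_modifiedMarginal k).mono Ioo_subset_Ico_self

theorem IsModifiedValue.hasFDerivWithinAt (hF : G.IsModifiedValue F) (hx : x ∈ G.feasible) :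
    HasFDerivWithinAt (fun z => ∑ k, F k (z k))
      (∑ k, G.modifiedMarginal k (x k) • (ContinuousLinearMap.proj k : (ι → ℝ) →L[ℝ] ℝ))
      G.feasible x :=
  hasFDerivWithinAt_sum_pi (fun _ hz k _ => hz.2 k) fun k => hF k _ (hx.2 k)

theorem IsModifiedValue.existsUnique_isMaxOn (hF : G.IsModifiedValue F) (hG : G.IsRegular) :
    ∃! x, x ∈ G.feasible ∧ IsMaxOn (fun x => ∑ k, F k (x k)) G.feasible x := by
  obtain ⟨x, hx, hmax⟩ := G.isCompact_feasible.exists_isMaxOn hG.nonempty_feasible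
    fun x hx => (hF.hasFDerivWithinAt hx).continuousWithinAt
  exact ⟨x, ⟨hx, hmax⟩, fun y hy => (hF.strictConcaveOn hG).eq_of_isMaxOn hy.2 hmax hy.1 hx⟩

theorem IsModifiedValue.isMaxOn_iff_exists_isSupportedBy (hF : G.IsModifiedValue F)
    (hG : G.IsRegular) (hx : x ∈ G.feasible) :
    IsMaxOn (fun x => ∑ k, F k (x k)) G.feasible x ↔ ∃ p, G.IsSupportedBy x p := by
  classical
  rw [isMaxOn_iff_of_concaveOn_of_hasFDerivWithinAt (hF.strictConcaveOn hG).concaveOn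
    (hF.hasFDerivWithinAt hx) hx]
  simp only [sum_apply, smul_apply,
    ContinuousLinearMap.proj_apply, Pi.sub_apply, smul_eq_mul]
  constructor
  · intro h
    obtain ⟨k, hk⟩ := hG.exists_lt_ceiling hx
    obtain ⟨p, hp⟩ := exists_multiplier (fun k => ordConnected_Icc) hx.2
      (fun w hw hsum => h w ⟨hsum.trans hx.1, hw⟩)
      ⟨k, G.ceiling k, right_mem_Icc.2 (hG.floor_lt_ceiling k).le, hk⟩
    exact ⟨p, hx, hp⟩
  · rintro ⟨p, hp⟩ y hy
    have hbalance : ∑ k, p * (y k - x k) = 0 := by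
      rw [← Finset.mul_sum, Finset.sum_sub_distrib, hy.1, hx.1, sub_self, mul_zero]
    calc ∑ k, G.modifiedMarginal k (x k) * (y k - x k)
        = ∑ k, (G.modifiedMarginal k (x k) - p) * (y k - x k) := by
          simp only [sub_mul, Finset.sum_sub_distrib, hbalance, sub_zero]
      _ ≤ 0 := Finset.sum_nonpos fun k _ => hp.variational k _ (hy.2 k)

theorem IsModifiedValue.isMaxOn_quantity [DecidableEq ι] (hF : G.IsModifiedValue F)
    (hG : G.IsRegular) (h : G.IsEquilibrium θ) :
    G.quantity θ ∈ G.feasible ∧ IsMaxOn (fun x => ∑ k, F k (x k)) G.feasible (G.quantity θ) :=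
  have hs := (hG.isEquilibrium_iff.1 h).2.2
  ⟨hs.mem_feasible, (hF.isMaxOn_iff_exists_isSupportedBy hG hs.mem_feasible).2 ⟨_, hs⟩⟩

theorem IsModifiedValue.exists_isEquilibrium [DecidableEq ι] (hF : G.IsModifiedValue F)
    (hG : G.IsRegular) : ∃ θ, G.IsEquilibrium θ := by
  obtain ⟨x, ⟨hx, hmax⟩, -⟩ := hF.existsUnique_isMaxOn hG
  obtain ⟨p, hp⟩ := (hF.isMaxOn_iff_exists_isSupportedBy hG hx).1 hmax
  exact ⟨_, hp.isEquilibrium_bids hG⟩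

-- The modified program determines the quantities, and a player strictly between floor and ceiling
-- then reveals the price as a modified marginal value.
theorem IsModifiedValue.existsUnique_isEquilibrium [DecidableEq ι] (hF : G.IsModifiedValue F)
    (hG : G.IsRegular)
    (hinterior : ∀ x p, G.IsSupportedBy x p → ∃ k, x k ∈ Ioo (G.floor k) (G.ceiling k)) :
    ∃! θ, G.IsEquilibrium θ := by
  refine existsUnique_of_exists_of_unique (hF.exists_isEquilibrium hG) fun θ θ' h h' => ?_
  obtain ⟨-, hp, hs⟩ := hG.isEquilibrium_iff.1 h
  obtain ⟨-, hp', hs'⟩ := hG.isEquilibrium_iff.1 h'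
  have hquantity : G.quantity θ = G.quantity θ' :=
    (hF.existsUnique_isMaxOn hG).unique (hF.isMaxOn_quantity hG h) (hF.isMaxOn_quantity hG h')
  obtain ⟨k, hk⟩ := hinterior _ _ hs
  have hprice : G.price θ = G.price θ' := by
    rw [← hs.modifiedMarginal_eq hk, hquantity, hs'.modifiedMarginal_eq (hquantity ▸ hk)]
  rw [← bids_quantity hp.ne', hquantity, hprice, bids_quantity hp'.ne']

end ModifiedProgram

end BidGame

namespace Market

variable {M N : ℕ} {m : Market M N}

/-- The market as a game for net quantities: a firm that supplies `s` buys `-s`. The ceiling of a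
consumer is the demand left by the other consumers' `d₀` when all firms produce at capacity. -/
def toBidGame (m : Market M N) : BidGame (Fin M ⊕ Fin N) where
  floor := Sum.elim (fun _ => m.d₀) fun _ => -m.κ₀
  ceiling := Sum.elim (fun _ => (N : ℝ) * m.κ₀ - ((M : ℝ) - 1) * m.d₀) fun _ => 0
  value := Sum.elim m.U fun j y => -m.C j (-y)

/-- An allocation as a profile of net quantities: demand, or minus the supply. -/
def netDemand : ((Fin M → ℝ) × (Fin N → ℝ)) ≃ₗ[ℝ] (Fin M ⊕ Fin N → ℝ) :=
  ((LinearEquiv.refl ℝ (Fin M → ℝ)).prodCongr (LinearEquiv.neg ℝ)).trans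
    (LinearEquiv.sumArrowLequivProdArrow (Fin M) (Fin N) ℝ ℝ).symm

/-- The modified utilities and costs as functions of net quantities. -/
noncomputable def modifiedValue (m : Market M N) : Fin M ⊕ Fin N → ℝ → ℝ :=
  Sum.elim m.modifiedUtility fun j y => -m.modifiedCost j (-y)

section Transfer

variable {θ x : (Fin M → ℝ) × (Fin N → ℝ)}

theorem surplus_toBidGame (m : Market M N) :
    m.toBidGame.surplus = (N : ℝ) * m.κ₀ - (M : ℝ) * m.d₀ := by
  simp only [BidGame.surplus, toBidGame, Fintype.sum_sum_type, Sum.elim_inl, Sum.elim_inr,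
    Finset.sum_const, Finset.card_univ, Fintype.card_fin, nsmul_eq_mul]
  ring

theorem reach_toBidGame_inl (m : Market M N) (i : Fin M) :
    m.toBidGame.reach (Sum.inl i) = (N : ℝ) * m.κ₀ - ((M : ℝ) - 1) * m.d₀ := by
  rw [BidGame.reach, surplus_toBidGame]
  simp only [toBidGame, Sum.elim_inl]
  ring

theorem reach_toBidGame_inr (m : Market M N) (j : Fin N) :
    m.toBidGame.reach (Sum.inr j) = ((N : ℝ) - 1) * m.κ₀ - (M : ℝ) * m.d₀ := by
  rw [BidGame.reach, surplus_toBidGame]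
  simp only [toBidGame, Sum.elim_inr]
  ring

theorem price_toBidGame (m : Market M N) (θ : (Fin M → ℝ) × (Fin N → ℝ)) :
    m.toBidGame.price (Sum.elim θ.1 θ.2) = m.price θ := by
  simp only [BidGame.price, surplus_toBidGame, price, Fintype.sum_sum_type, Sum.elim_inl,
    Sum.elim_inr]

theorem quantity_toBidGame (m : Market M N) (θ : (Fin M → ℝ) × (Fin N → ℝ)) :
    m.toBidGame.quantity (Sum.elim θ.1 θ.2) = netDemand (m.allocation θ) := by
  funext k
  rw [BidGame.quantity, price_toBidGame]
  rcases k with i | j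
  · rfl
  · exact (neg_add_eq_sub _ _).trans (neg_sub _ _).symm

theorem payoff_toBidGame_inl (m : Market M N) (θ : (Fin M → ℝ) × (Fin N → ℝ)) (i : Fin M) :
    m.toBidGame.payoff (Sum.inl i) (Sum.elim θ.1 θ.2) = m.consumerPayoff i θ := by
  rw [BidGame.payoff, quantity_toBidGame, price_toBidGame]
  rfl

theorem payoff_toBidGame_inr (m : Market M N) (θ : (Fin M → ℝ) × (Fin N → ℝ)) (j : Fin N) :
    m.toBidGame.payoff (Sum.inr j) (Sum.elim θ.1 θ.2) = m.firmPayoff j θ := by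
  have hvalue : m.toBidGame.value (Sum.inr j) (netDemand (m.allocation θ) (Sum.inr j)) =
      -m.C j (m.supplyOffer (θ.2 j) (m.price θ)) :=
    congrArg (fun s => -m.C j s) (neg_neg _)
  rw [BidGame.payoff, quantity_toBidGame, price_toBidGame, hvalue, firmPayoff]
  simp only [toBidGame, Sum.elim_inr]
  ring

theorem isEquilibrium_toBidGame_iff :
    m.toBidGame.IsEquilibrium (Sum.elim θ.1 θ.2) ↔ m.IsNashEquilibrium θ := by
  have hinl (i : Fin M) (t : ℝ) : m.toBidGame.payoff (.inl i)
      (Function.update (Sum.elim θ.1 θ.2) (.inl i) t) =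
        m.consumerPayoff i (Function.update θ.1 i t, θ.2) := by
    rw [← Sum.elim_update_left, ← payoff_toBidGame_inl]
  have hinr (j : Fin N) (t : ℝ) : m.toBidGame.payoff (.inr j)
      (Function.update (Sum.elim θ.1 θ.2) (.inr j) t) =
        m.firmPayoff j (θ.1, Function.update θ.2 j t) := by
    rw [← Sum.elim_update_right, ← payoff_toBidGame_inr]
  constructor
  · rintro ⟨hnonneg, hbest⟩
    refine ⟨fun i => hnonneg (.inl i), fun j => hnonneg (.inr j), fun i t ht => ?_,
      fun j t ht => ?_⟩
    · simpa only [hinl, payoff_toBidGame_inl] using hbest (.inl i) t ht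
    · simpa only [hinr, payoff_toBidGame_inr] using hbest (.inr j) t ht
  · rintro ⟨hconsumer, hfirm, hconsumer_best, hfirm_best⟩
    refine ⟨Sum.rec hconsumer hfirm, Sum.rec (fun i t ht => ?_) fun j t ht => ?_⟩
    · simpa only [hinl, payoff_toBidGame_inl] using hconsumer_best i t ht
    · simpa only [hinr, payoff_toBidGame_inr] using hfirm_best j t ht

theorem sum_netDemand (x : (Fin M → ℝ) × (Fin N → ℝ)) :
    ∑ k, netDemand x k = ∑ i, x.1 i - ∑ j, x.2 j := by
  rw [Fintype.sum_sum_type, sub_eq_add_neg, ← Finset.sum_neg_distrib]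
  rfl

theorem sum_modifiedValue_netDemand (m : Market M N) (x : (Fin M → ℝ) × (Fin N → ℝ)) :
    ∑ k, m.modifiedValue k (netDemand x k) = m.modifiedWelfare x := by
  rw [Fintype.sum_sum_type, modifiedWelfare, sub_eq_add_neg, ← Finset.sum_neg_distrib]
  congr 2 with j
  exact congrArg (fun s => -m.modifiedCost j s) (neg_neg _)

theorem demand_le_of_mem_feasible (hx : x ∈ m.feasible) (i : Fin M) :
    x.1 i ≤ (N : ℝ) * m.κ₀ - ((M : ℝ) - 1) * m.d₀ := by
  have hsupply : ∑ j, x.2 j ≤ (N : ℝ) * m.κ₀ := by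
    simpa using Finset.sum_le_card_nsmul Finset.univ x.2 m.κ₀ fun j _ => (hx.2.1 j).2
  have hexcess : x.1 i - m.d₀ ≤ ∑ i, (x.1 i - m.d₀) :=
    Finset.single_le_sum (f := fun i => x.1 i - m.d₀) (fun i _ => sub_nonneg.2 (hx.2.2 i))
      (Finset.mem_univ i)
  simp only [Finset.sum_sub_distrib, hx.1, Finset.sum_const, Finset.card_univ, Fintype.card_fin,
    nsmul_eq_mul] at hexcess
  linarith

theorem netDemand_mem_feasible_iff :
    netDemand x ∈ m.toBidGame.feasible ↔ x ∈ m.feasible := by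
  constructor
  · rintro ⟨hsum, hbox⟩
    rw [sum_netDemand, sub_eq_zero] at hsum
    exact ⟨hsum, fun j => ⟨neg_nonpos.1 (hbox (.inr j)).2, neg_le_neg_iff.1 (hbox (.inr j)).1⟩,
      fun i => (hbox (.inl i)).1⟩
  · intro hx
    refine ⟨by rw [sum_netDemand, hx.1, sub_self], Sum.rec (fun i => ?_) fun j => ?_⟩
    · exact ⟨hx.2.2 i, demand_le_of_mem_feasible hx i⟩
    · exact ⟨neg_le_neg (hx.2.1 j).2, neg_nonpos.2 (hx.2.1 j).1⟩

theorem solvesModifiedProgram_iff :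
    netDemand x ∈ m.toBidGame.feasible ∧
      IsMaxOn (fun y => ∑ k, m.modifiedValue k (y k)) m.toBidGame.feasible (netDemand x) ↔
      m.SolvesModifiedProgram x := by
  simp only [SolvesModifiedProgram, isMaxOn_iff, netDemand.surjective.forall,
    netDemand_mem_feasible_iff, sum_modifiedValue_netDemand]

theorem concaveOn_modifiedWelfare
    (h : ConcaveOn ℝ m.toBidGame.feasible fun y => ∑ k, m.modifiedValue k (y k)) :
    ConcaveOn ℝ m.feasible m.modifiedWelfare := by
  have hfeasible : netDemand ⁻¹' m.toBidGame.feasible = m.feasible :=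
    Set.ext fun _ => netDemand_mem_feasible_iff
  rw [← hfeasible]
  exact (h.comp_linearMap netDemand.toLinearMap).congr fun x _ => m.sum_modifiedValue_netDemand x

end Transfer

section Regularity

theorem ConcaveUtilitiesConvexCosts.concaveOn_value (h : m.ConcaveUtilitiesConvexCosts)
    (k : Fin M ⊕ Fin N) :
    ConcaveOn ℝ (Icc (m.toBidGame.floor k) (m.toBidGame.ceiling k)) (m.toBidGame.value k) := by
  rcases k with i | j
  · exact (h.utility_concave i).subset Icc_subset_Ici_self (convex_Icc _ _)
  · exact ((h.cost_convex j).comp_linearMap (-LinearMap.id)).neg.subset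
      (fun y hy => neg_nonneg.2 hy.2) (convex_Icc _ _)

theorem ConcaveUtilitiesConvexCosts.strictMonoOn_value (h : m.ConcaveUtilitiesConvexCosts)
    (k : Fin M ⊕ Fin N) :
    StrictMonoOn (m.toBidGame.value k) (Icc (m.toBidGame.floor k) (m.toBidGame.ceiling k)) := by
  rcases k with i | j
  · exact (h.utility_strictMono i).mono Icc_subset_Ici_self
  · exact fun y hy z hz hyz => neg_lt_neg <| h.cost_strictMono j (neg_nonneg.2 hz.2)
      (neg_nonneg.2 hy.2) (neg_lt_neg hyz)

theorem ConcaveUtilitiesConvexCosts.differentiableOn_value (h : m.ConcaveUtilitiesConvexCosts)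
    (k : Fin M ⊕ Fin N) :
    DifferentiableOn ℝ (m.toBidGame.value k)
      (Icc (m.toBidGame.floor k) (m.toBidGame.ceiling k)) := by
  rcases k with i | j
  · exact ((h.utility_contDiff i).differentiableOn one_ne_zero).mono Icc_subset_Ici_self
  · exact (((h.cost_contDiff j).differentiableOn one_ne_zero).comp
      differentiable_neg.differentiableOn fun y hy => neg_nonneg.2 hy.2).neg

theorem spareCapacity_pos (hM : 0 < M) (hN : 0 < N) (hd₀ : 0 < m.d₀) (h : m.NoPivotalSupplier) :
    0 < ((N : ℝ) - 1) * m.κ₀ - (M : ℝ) * m.d₀ := by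
  have hrsi := h ⟨0, hN⟩
  rwa [rsi, one_lt_div (by positivity), ← sub_pos] at hrsi

theorem isRegular_toBidGame (hM : 0 < M) (hd₀ : 0 < m.d₀) (hκ₀ : 0 < m.κ₀)
    (hcap : (M : ℝ) * m.d₀ < (N : ℝ) * m.κ₀) (h1 : m.ConcaveUtilitiesConvexCosts)
    (h2 : m.NoPivotalSupplier) : m.toBidGame.IsRegular where
  reach_pos := by
    rintro (i | j)
    · rw [reach_toBidGame_inl]
      linarith
    · rw [reach_toBidGame_inr]
      exact spareCapacity_pos hM j.pos hd₀ h2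
  floor_lt_ceiling := by
    rintro (i | _)
    · change m.d₀ < (N : ℝ) * m.κ₀ - ((M : ℝ) - 1) * m.d₀
      linarith
    · exact neg_neg_of_pos hκ₀
  ceiling_le_reach := by
    rintro (i | j)
    · exact (m.reach_toBidGame_inl i).ge
    · rw [reach_toBidGame_inr]
      exact (spareCapacity_pos hM j.pos hd₀ h2).le
  sum_ceiling_pos := by
    simp only [toBidGame, Fintype.sum_sum_type, Sum.elim_inl, Sum.elim_inr, Finset.sum_const,
      Finset.card_univ, Fintype.card_fin, nsmul_eq_mul, mul_zero, add_zero]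
    exact mul_pos (by positivity) (by linarith)
  concaveOn := h1.concaveOn_value
  strictMonoOn := h1.strictMonoOn_value
  differentiableOn := h1.differentiableOn_value
  value_eq := by
    rintro (i | j) y hy
    · rw [reach_toBidGame_inl] at hy
      rw [le_antisymm hy.2 hy.1]
      rfl
    · exact congrArg Neg.neg ((h1.cost_nonpos j _ (neg_nonpos.2 hy.1)).trans
        (h1.cost_nonpos j _ neg_zero.le).symm)

theorem neg_modifiedCost_neg (m : Market M N) (j : Fin N) (y : ℝ) :
    -m.modifiedCost j (-y) = (1 - y / (((N : ℝ) - 1) * m.κ₀ - (M : ℝ) * m.d₀)) * -m.C j (-y) +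
      1 / (((N : ℝ) - 1) * m.κ₀ - (M : ℝ) * m.d₀) * ∫ z in (0 : ℝ)..y, -m.C j (-z) := by
  have hint : ∫ z in (0 : ℝ)..y, -m.C j (-z) = ∫ z in (0 : ℝ)..-y, m.C j z := by
    rw [intervalIntegral.integral_neg, intervalIntegral.integral_comp_neg, neg_zero,
      ← intervalIntegral.integral_symm]
  rw [hint, modifiedCost]
  ring

theorem isModifiedValue_modifiedValue (h : m.toBidGame.IsRegular) :
    m.toBidGame.IsModifiedValue m.modifiedValue := by
  rintro (i | j) y hy
  · rw [BidGame.modifiedMarginal, reach_toBidGame_inl]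
    exact hasDerivWithinAt_one_sub_div_mul_add_integral
      (left_mem_Icc.2 (h.floor_lt_ceiling (.inl i)).le) (h.differentiableOn (.inl i)).continuousOn
      hy (h.differentiableOn (.inl i) y hy).hasDerivWithinAt
  · rw [BidGame.modifiedMarginal, reach_toBidGame_inr]
    refine (hasDerivWithinAt_one_sub_div_mul_add_integral
      (right_mem_Icc.2 (h.floor_lt_ceiling (.inr j)).le)
      (h.differentiableOn (.inr j)).continuousOn hy
      (h.differentiableOn (.inr j) y hy).hasDerivWithinAt).congr_of_mem
      (fun z _ => m.neg_modifiedCost_neg j z) hy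

end Regularity

section InteriorPlayers

variable {x : Fin M ⊕ Fin N → ℝ} {p : ℝ}

theorem derivWithin_neg_cost_neg_eq_zero (h1 : m.ConcaveUtilitiesConvexCosts) {j : Fin N}
    (hκ₀ : 0 < m.κ₀) (hC : DifferentiableAt ℝ (m.C j) 0) :
    derivWithin (fun y => -m.C j (-y)) (Icc (-m.κ₀) 0) 0 = 0 := by
  have hderiv : deriv (m.C j) 0 = 0 := by
    have hconst : HasDerivWithinAt (m.C j) 0 (Iic 0) 0 :=
      (hasDerivWithinAt_const 0 (Iic 0) (0 : ℝ)).congr (h1.cost_nonpos j)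
        (h1.cost_nonpos j 0 le_rfl)
    exact (uniqueDiffWithinAt_Iic 0).eq_deriv _ hC.hasDerivAt.hasDerivWithinAt hconst
  have hneg : HasDerivAt (fun y => -m.C j (-y)) 0 0 := by
    have hC' : HasDerivAt (m.C j) 0 (-0) := by
      rw [neg_zero]
      exact hC.hasDerivAt.congr_deriv hderiv
    exact (hC'.comp 0 (hasDerivAt_neg 0)).neg.congr_deriv (by ring)
  exact hneg.hasDerivWithinAt.derivWithin
    (uniqueDiffOn_Icc (neg_neg_of_pos hκ₀) 0 (right_mem_Icc.2 (neg_neg_of_pos hκ₀).le))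

theorem modifiedMarginal_ceiling_eq_zero (h : m.toBidGame.IsRegular)
    (h1 : m.ConcaveUtilitiesConvexCosts) (hκ₀ : 0 < m.κ₀)
    (hC : ∀ j, DifferentiableAt ℝ (m.C j) 0) (k : Fin M ⊕ Fin N) :
    m.toBidGame.modifiedMarginal k (m.toBidGame.ceiling k) = 0 := by
  rcases k with i | j
  · exact h.modifiedMarginal_ceiling_eq_zero (m.reach_toBidGame_inl i).symm
  · exact mul_eq_zero_of_right _ (derivWithin_neg_cost_neg_eq_zero h1 hκ₀ (hC j))

-- If all players are at a corner, every consumer gets `d₀` and every firm produces `0` or `κ₀`.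
theorem exists_mem_Ioo_of_ne_mul (h : m.toBidGame.IsRegular)
    (hs : m.toBidGame.IsSupportedBy x p)
    (hne : ∀ k : ℕ, (M : ℝ) * m.d₀ ≠ (k : ℝ) * m.κ₀) :
    ∃ k, x k ∈ Ioo (m.toBidGame.floor k) (m.toBidGame.ceiling k) := by
  by_contra! hcorner
  have hconsumer (i : Fin M) : x (.inl i) = m.d₀ := by
    have hlt := (hs.lt_reach h (.inl i)).trans_eq (m.reach_toBidGame_inl i)
    exact ((hs.mem_feasible.2 (.inl i)).1.antisymm' <| not_lt.1 fun hd =>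
      hcorner (.inl i) ⟨hd, hlt⟩)
  have hfirm (j : Fin N) : x (.inr j) = if x (.inr j) = -m.κ₀ then -m.κ₀ else 0 := by
    split_ifs with hfull
    · exact hfull
    · have hbox := hs.mem_feasible.2 (.inr j)
      exact hbox.2.antisymm <| not_lt.1 fun hneg =>
        hcorner (.inr j) ⟨hbox.1.lt_of_ne' hfull, hneg⟩
  refine hne (Finset.univ.filter fun j => x (.inr j) = -m.κ₀).card ?_
  have hsum := hs.mem_feasible.1
  rw [Fintype.sum_sum_type, Finset.sum_congr rfl fun i _ => hconsumer i,
    Finset.sum_congr rfl fun j _ => hfirm j, ← Finset.sum_filter] at hsum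
  simp only [Finset.sum_const, Finset.card_univ, Fintype.card_fin, nsmul_eq_mul, mul_neg] at hsum
  linarith

end InteriorPlayers

end Market

theorem theorem2 {M N : ℕ} (m : Market M N) (hM : 0 < M) (hd₀ : 0 < m.d₀) (hκ₀ : 0 < m.κ₀)
    (hcap : (M : ℝ) * m.d₀ < (N : ℝ) * m.κ₀)
    (h1 : m.ConcaveUtilitiesConvexCosts) (h2 : m.NoPivotalSupplier) :
    -- a Nash equilibrium exists, and it is unique if the costs (which vanish on `(-∞, 0]`) are
    -- continuously differentiable on the whole line, or if the inelastic demand is not a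
    -- multiple of the capacity
    (∃ θ, m.IsNashEquilibrium θ) ∧
    (((∀ j, ContDiff ℝ 1 (m.C j)) ∨ (∀ k : ℕ, (M : ℝ) * m.d₀ ≠ (k : ℝ) * m.κ₀)) →
      ∃! θ, m.IsNashEquilibrium θ) ∧
    -- the program is convex, has exactly one solution, and this is the allocation at every
    -- Nash equilibrium
    ConcaveOn ℝ m.feasible m.modifiedWelfare ∧
    (∃! x, m.SolvesModifiedProgram x) ∧
    (∀ θ, m.IsNashEquilibrium θ →
      0 < m.price θ ∧ m.SolvesModifiedProgram (m.allocation θ)) := by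
  have hG := Market.isRegular_toBidGame hM hd₀ hκ₀ hcap h1 h2
  have hF := Market.isModifiedValue_modifiedValue hG
  let e := (Equiv.sumArrowEquivProdArrow (Fin M) (Fin N) ℝ).symm
  refine ⟨?_, fun hC => ?_, Market.concaveOn_modifiedWelfare (hF.strictConcaveOn hG).concaveOn,
    ?_, fun θ hθ => ?_⟩
  · exact (e.exists_congr fun _ => Market.isEquilibrium_toBidGame_iff.symm).2
      (hF.exists_isEquilibrium hG)
  · refine (e.existsUnique_congr fun _ => Market.isEquilibrium_toBidGame_iff.symm).2
      (hF.existsUnique_isEquilibrium hG fun x p hs => ?_)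
    rcases hC with hC | hC
    · exact hs.exists_mem_Ioo hG <| Market.modifiedMarginal_ceiling_eq_zero hG h1 hκ₀ fun j =>
        (hC j).differentiable one_ne_zero 0
    · exact Market.exists_mem_Ioo_of_ne_mul hG hs hC
  · exact (Market.netDemand.toEquiv.existsUnique_congr fun _ =>
      Market.solvesModifiedProgram_iff.symm).2 (hF.existsUnique_isMaxOn hG)
  · have h := Market.isEquilibrium_toBidGame_iff.2 hθ
    have hprice := (hG.isEquilibrium_iff.1 h).2.1
    have hsolves := hF.isMaxOn_quantity hG h
    rw [Market.price_toBidGame] at hprice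
    rw [Market.quantity_toBidGame] at hsolves
    exact ⟨hprice, Market.solvesModifiedProgram_iff.1 hsolves⟩
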